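/- Let $M$ be a smooth manifold modelled on a convenient vector space $E$ (a Hausdorff locally convex real topological vector space in which every smooth curve has a smooth antiderivative), where a map is smooth if it sends smooth curves to smooth curves. Let $\eta$ be a smooth (kinematic) 1-form on $M$ and write $$\flat(v)=\iota_v\,d\eta+\eta(v)\,\eta ,\qquad v\in TM .$$ Assume that $\eta$ is a (weakly) contact form: at every point $d\eta$ has a non-zero kernel, and $\flat$ is injective on every tangent space. Let $R$ be the Reeb vector field, determined at each point by $\eta(R)=1$ and $\iota_R\,d\eta=0$, and write $R(H)=dH(R)$. For $H\in C^\infty(M)$, a smooth vector field $X$ on $M$ is called a (contact) Hamiltonian vector field of $H$ if there is an $f\in C^\infty(M)$ such that $$\eta(X)=-H\qquad\text{and}\qquad \mathcal L_X\eta=f\eta .\tag{1}$$ Then, for every $H\in C^\infty(M)$: 1. $H$ has at most one Hamiltonian vector field. 2. If a smooth vector field $X$ and a function $f\in C^\infty(M)$ satisfy (1), then $$f=-R(H)\qquad\text{and}\qquad \flat(X)=dH-\bigl(R(H)+H\bigr)\eta .$$ -/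

import Mathlib

open scoped Topology

/-! Smooth calculus on locally convex spaces, by testing along smooth curves. -/

namespace Convenient

/-- A curve in a topological vector space is smooth if all its iterated derivatives exist.
(Each of them is then continuous, being differentiable.) -/
def IsSmoothCurve {F : Type*} [AddCommGroup F] [Module ℝ F] [TopologicalSpace F]
    (c : ℝ → F) : Prop :=
  ∀ n : ℕ, Differentiable ℝ (deriv^[n] c)

/-- A map `f` defined on a subset `U` of a locally convex space is smooth if it sends smooth
curves in `U` to smooth curves. Values of `f` outside `U` are irrelevant. -/
def IsSmoothMapOn {E F : Type*} [AddCommGroup E] [Module ℝ E] [TopologicalSpace E]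
    [AddCommGroup F] [Module ℝ F] [TopologicalSpace F] (f : E → F) (U : Set E) : Prop :=
  ∀ c : ℝ → E, IsSmoothCurve c → (∀ t, c t ∈ U) → IsSmoothCurve (f ∘ c)

/-- A (Hausdorff, locally convex) space is convenient if every smooth curve in it is the derivative
of a smooth curve. -/
class ConvenientSpace (E : Type*) [AddCommGroup E] [Module ℝ E] [TopologicalSpace E]
    [IsTopologicalAddGroup E] [ContinuousSMul ℝ E] [LocallyConvexSpace ℝ E] [T2Space E] :
    Prop where
  exists_antiderivative : ∀ c : ℝ → E, IsSmoothCurve c →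
    ∃ C : ℝ → E, IsSmoothCurve C ∧ ∀ t, HasDerivAt C (c t) t

/-- A manifold modelled on `E`: the chart changes of the atlas are smooth. -/
class IsConvenientManifold (E M : Type*) [AddCommGroup E] [Module ℝ E] [TopologicalSpace E]
    [TopologicalSpace M] [ChartedSpace E M] : Prop where
  smooth_chart_change : ∀ e ∈ atlas E M, ∀ e' ∈ atlas E M,
    IsSmoothMapOn (e' ∘ e.symm) (e.symm.trans e').source

section Manifold

variable (E : Type*) [AddCommGroup E] [Module ℝ E] [TopologicalSpace E]
  {M : Type*} [TopologicalSpace M] [ChartedSpace E M]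

/-- A continuous path in `M` is smooth if it is smooth in every chart, wherever it is defined. -/
def IsSmoothPath (c : ℝ → M) : Prop :=
  Continuous c ∧ ∀ e ∈ atlas E M, ∀ n : ℕ, ∀ t : ℝ, c t ∈ e.source →
    DifferentiableAt ℝ (deriv^[n] (e ∘ c)) t

/-- The elements of `C^∞(M)`. -/
def IsSmoothFunction (f : M → ℝ) : Prop :=
  Continuous f ∧ ∀ c : ℝ → M, IsSmoothPath E c → IsSmoothCurve (f ∘ c)

/-- The kinematic tangent space at `p`, identified with the model space through the preferred chart
`φ = chartAt E p` (as in Mathlib's `TangentSpace`): `v : E` stands for the class of the path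
`t ↦ φ⁻¹ (φ p + t v)`. -/
abbrev TangentVector (_p : M) : Type _ := E

variable {E}

/-- The coordinates in the chart `e` of the tangent vector `v` at `p`: the velocity at time `0`,
seen in `e`, of the path `t ↦ φ⁻¹ (φ p + t v)`, where `φ = chartAt E p`. -/
noncomputable def chartVector (e : OpenPartialHomeomorph M E) (p : M) (v : TangentVector E p) : E :=
  deriv (fun t : ℝ => e ((chartAt E p).symm (chartAt E p p + t • v))) 0

/-- The local representative in the chart `e` of a section `X` of the tangent bundle. -/
noncomputable def chartField (e : OpenPartialHomeomorph M E) (X : (p : M) → TangentVector E p)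
    (y : E) : E :=
  chartVector e (e.symm y) (X (e.symm y))

variable (E M)

/-- Kinematic vector fields: sections of the tangent bundle whose local representatives in the
charts are smooth. -/
@[ext]
structure SmoothVectorField where
  toFun : (p : M) → TangentVector E p
  smooth' : ∀ e ∈ atlas E M, IsSmoothMapOn (chartField e toFun) e.target

/-- Kinematic 1-forms: sections of the kinematic cotangent bundle, whose fibre is the space of
continuous linear functionals on the tangent space. The local representative `α` in a chart is
required to be a smooth map into the strong dual of the model space. -/
structure OneForm [IsTopologicalAddGroup E] [ContinuousSMul ℝ E] where
  toFun : (p : M) → TangentVector E p →L[ℝ] ℝ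
  smooth' : ∀ e ∈ atlas E M, ∃ α : E → StrongDual ℝ E, IsSmoothMapOn α e.target ∧
    ∀ p ∈ e.source, ∀ v : TangentVector E p, α (e p) (chartVector e p v) = toFun p v

variable {E M}

/-- The differential of a function, `dH_p(v)`. -/
noncomputable def differential (H : M → ℝ) (p : M) (v : TangentVector E p) : ℝ :=
  deriv (fun t : ℝ => H ((chartAt E p).symm (chartAt E p p + t • v))) 0

variable [IsTopologicalAddGroup E] [ContinuousSMul ℝ E]

namespace OneForm

/-- The local representative of `η` in the preferred chart at `p`. (It is determined by `η` on the
target of this chart, because `chartVector e q` is a bijection for every `q` in the domain of a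
chart `e`.) -/
noncomputable def rep (η : OneForm E M) (p : M) : E → StrongDual ℝ E :=
  (η.smooth' (chartAt E p) (chart_mem_atlas E p)).choose

/-- The exterior derivative, `dη_p(v, w) = (D_v η)(w) - (D_w η)(v)`, computed in the preferred chart
at `p`. -/
noncomputable def extDeriv (η : OneForm E M) (p : M) (v w : TangentVector E p) : ℝ :=
  deriv (fun t : ℝ => η.rep p (chartAt E p p + t • v) w) 0
    - deriv (fun t : ℝ => η.rep p (chartAt E p p + t • w) v) 0

/-- The Lie derivative, `(L_X η)_p(v) = (D_X η)(v) + η(D_v X)`, computed in the preferred chart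
at `p`. -/
noncomputable def lieDeriv (X : SmoothVectorField E M) (η : OneForm E M) (p : M)
    (v : TangentVector E p) : ℝ :=
  deriv (fun t : ℝ => η.rep p (chartAt E p p + t • X.toFun p) v) 0
    + η.toFun p (deriv (fun t : ℝ => chartField (chartAt E p) X.toFun (chartAt E p p + t • v)) 0)

/-- The map `♭`, `♭(v) = ι_v dη + η(v) η`. -/
noncomputable def flat (η : OneForm E M) (p : M) (v : TangentVector E p) :
    TangentVector E p → ℝ :=
  fun w => η.extDeriv p v w + η.toFun p v * η.toFun p w

/-- (Weakly) contact forms: `dη` has non-zero kernel at every point and `♭` is injective on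
every tangent space. -/
structure IsContact (η : OneForm E M) : Prop where
  degenerate : ∀ p : M, ∃ v : TangentVector E p, v ≠ 0 ∧ ∀ w, η.extDeriv p v w = 0
  flat_injective : ∀ p : M, Function.Injective (η.flat p)

theorem extDeriv_smul (η : OneForm E M) (p : M) (a : ℝ) (v w : TangentVector E p) :
    η.extDeriv p (a • v) w = a * η.extDeriv p v w := by
  have h1 : deriv (fun t : ℝ => η.rep p (chartAt E p p + t • a • v) w) 0
      = a * deriv (fun t : ℝ => η.rep p (chartAt E p p + t • v) w) 0 := by
    have := deriv_comp_mul_left a (fun t : ℝ => η.rep p (chartAt E p p + t • v) w) 0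
    simpa [smul_smul, mul_comm] using this
  unfold extDeriv
  rw [h1]
  simp only [map_smul, smul_eq_mul, deriv_const_mul_field]
  ring

theorem IsContact.existsUnique_reeb {η : OneForm E M} (hη : η.IsContact) (p : M) :
    ∃! r : TangentVector E p, η.toFun p r = 1 ∧ ∀ w, η.extDeriv p r w = 0 := by
  obtain ⟨v, hv, hd⟩ := hη.degenerate p
  have h0 : η.toFun p v ≠ 0 := by
    intro h
    apply hv
    apply hη.flat_injective p
    funext w
    have : η.extDeriv p 0 w = 0 := by simpa using η.extDeriv_smul p 0 0 w
    simp [flat, hd, h, this]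
  refine ⟨(η.toFun p v)⁻¹ • v, ⟨by simp [h0], fun w => by simp [extDeriv_smul, hd]⟩, ?_⟩
  rintro r ⟨hr1, hr2⟩
  apply hη.flat_injective p
  funext w
  simp [flat, hr1, hr2, extDeriv_smul, hd, h0]

/-- The Reeb vector field `R` of a contact form: `η(R) = 1` and `ι_R dη = 0`. -/
noncomputable def IsContact.reeb {η : OneForm E M} (hη : η.IsContact) (p : M) :
    TangentVector E p :=
  (hη.existsUnique_reeb p).choose

/-- The two conditions on a contact Hamiltonian vector field `X` of `H` with conformal factor `f`:
`η(X) = -H` and `L_X η = f η`. -/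
def HamiltonianConditions (η : OneForm E M) (H : M → ℝ) (X : SmoothVectorField E M)
    (f : M → ℝ) : Prop :=
  (∀ p, η.toFun p (X.toFun p) = - H p) ∧ ∀ p v, η.lieDeriv X p v = f p * η.toFun p v

/-- Contact Hamiltonian vector fields of `H`. -/
def IsHamiltonianVectorField (η : OneForm E M) (H : M → ℝ) (X : SmoothVectorField E M) : Prop :=
  ∃ f : M → ℝ, IsSmoothFunction E f ∧ η.HamiltonianConditions H X f

end OneForm

end Manifold

end Convenient

/-! Cartan's formula (`lieDeriv_eq`) together with `η(X) = -H` turns `L_X η = f η` into `ι_X dη = dH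
+ f η`. Evaluating at the Reeb vector kills the left side and gives `f = -R(H)`; adding `η(X) η = -H
η` then gives `♭(X)`, in which `f` no longer appears. Injectivity of `♭` yields uniqueness. The
analytic content is Cartan's formula, that is, the product rule for `η(X)` in a chart
(`differential_pairing`). Two difficulties arise: evaluation on `E' × E` need not be jointly
continuous (`hasDerivAt_pairing`), and smoothness is only tested along curves that stay in the chart
for all times (`exists_isSmoothCurve_eventuallyEq_line`). -/

namespace Convenient

open Filter

/-! ### Calculus of curves in topological vector spaces -/

section Calculus

theorem hasDerivAt_deriv {F : Type*} [AddCommGroup F] [Module ℝ F] [TopologicalSpace F]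
    [ContinuousSMul ℝ F] {f : ℝ → F} {x : ℝ} (h : DifferentiableAt ℝ f x) :
    HasDerivAt f (deriv f x) x :=
  h.hasFDerivAt.hasDerivAt

variable {E F : Type*} [AddCommGroup E] [Module ℝ E] [TopologicalSpace E]
  [IsTopologicalAddGroup E] [ContinuousSMul ℝ E]
  [AddCommGroup F] [Module ℝ F] [TopologicalSpace F]
  [IsTopologicalAddGroup F] [ContinuousSMul ℝ F]

theorem hasDerivAt_iff_tendsto_inv_smul {f : ℝ → F} {f' : F} {x : ℝ} :
    HasDerivAt f f' x ↔ Tendsto (fun y => (y - x)⁻¹ • (f y - f x)) (𝓝[≠] x) (𝓝 f') := by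
  have h1 : HasDerivAt f f' x ↔
      Tendsto (fun y => (y - x)⁻¹ • (f y - f x - (y - x) • f')) (𝓝 x) (𝓝 0) := by
    rw [hasDerivAt_iff_hasFDerivAt, hasFDerivAt_iff_isLittleOTVS]
    simp only [ContinuousLinearMap.toSpanSingleton_apply]
    refine Asymptotics.isLittleOTVS_iff_tendsto_inv_smul (Eventually.of_forall fun y hy => ?_)
    obtain rfl : y = x := sub_eq_zero.1 hy
    simp
  have h2 : Tendsto (fun y => (y - x)⁻¹ • (f y - f x - (y - x) • f')) (𝓝 x) (𝓝 0) ↔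
      Tendsto (fun y => (y - x)⁻¹ • (f y - f x - (y - x) • f')) (𝓝[≠] x) (𝓝 0) := by
    refine ⟨fun h => h.mono_left nhdsWithin_le_nhds, fun h => ?_⟩
    rw [← pure_sup_nhdsNE, tendsto_sup]
    refine ⟨?_, h⟩
    rw [tendsto_pure_left]
    intro s hs
    simpa using mem_of_mem_nhds hs
  have h3 : (fun y => (y - x)⁻¹ • (f y - f x - (y - x) • f')) =ᶠ[𝓝[≠] x]
      fun y => (y - x)⁻¹ • (f y - f x) - f' := by
    filter_upwards [self_mem_nhdsWithin] with y hy
    rw [smul_sub, inv_smul_smul₀ (sub_ne_zero.2 hy)]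
  rw [h1, h2, tendsto_congr' h3]
  exact tendsto_sub_nhds_zero_iff

theorem deriv_eq_of_hasDerivAt [T2Space F] {f : ℝ → F} {f' : F} {x : ℝ}
    (h : HasDerivAt f f' x) : deriv f x = f' := by
  have := (DifferentiableAt.hasFDerivAt ⟨_, h.hasFDerivAt⟩).unique h.hasFDerivAt
  simp [deriv, this]

theorem continuousAt_of_hasDerivAt {f : ℝ → F} {f' : F} {x : ℝ} (h : HasDerivAt f f' x) :
    ContinuousAt f x := by
  have h1 := hasDerivAt_iff_tendsto_inv_smul.1 h
  have h2 : Tendsto (fun y : ℝ => y - x) (𝓝[≠] x) (𝓝 0) := by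
    have : Tendsto (fun y : ℝ => y - x) (𝓝 x) (𝓝 (x - x)) :=
      tendsto_id.sub_const x
    simpa using this.mono_left nhdsWithin_le_nhds
  have h3 := (h2.smul h1).const_add (f x)
  rw [zero_smul, add_zero] at h3
  rw [continuousAt_iff_punctured_nhds]
  refine h3.congr' ?_
  filter_upwards [self_mem_nhdsWithin] with y hy
  rw [smul_inv_smul₀ (sub_ne_zero.2 hy)]
  abel

theorem hasDerivAt_const_add_smul_const {g : ℝ → ℝ} {g' x : ℝ} (a v : E)
    (h : HasDerivAt g g' x) : HasDerivAt (fun t => a + g t • v) (g' • v) x := by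
  rw [hasDerivAt_iff_tendsto_inv_smul] at h ⊢
  refine (h.smul_const v).congr fun y => ?_
  rw [add_sub_add_left_eq_sub, ← sub_smul, smul_assoc]

/-- Product rule for the evaluation pairing; uniform convergence on the bounded image of a compact
interval replaces joint continuity of the pairing. -/
theorem hasDerivAt_pairing {A : ℝ → StrongDual ℝ E} {A' : StrongDual ℝ E} {c : ℝ → E} {c' : E}
    {x : ℝ} (hA : HasDerivAt A A' x) (hc : HasDerivAt c c' x) (hcont : Continuous c) :
    HasDerivAt (fun t => A t (c t)) (A' (c x) + A x c') x := by
  have hA' := hasDerivAt_iff_tendsto_inv_smul.1 hA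
  have hc' := hasDerivAt_iff_tendsto_inv_smul.1 hc
  rw [hasDerivAt_iff_tendsto_inv_smul]
  have hbdd : Bornology.IsVonNBounded ℝ (c '' Metric.closedBall x 1) :=
    IsCompact.isVonNBounded ℝ ((isCompact_closedBall x 1).image hcont)
  -- The quotient of the pairing is `(Q - A') (c y) + A' (c y) + A x (q)`, with `Q`, `q` the
  -- quotients of `A`, `c`. Only the first term has both entries moving; there `Q → A'` uniformly on
  -- bounded sets.
  have h1 : Tendsto (fun y => ((y - x)⁻¹ • (A y - A x) - A') (c y)) (𝓝[≠] x) (𝓝 0) := by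
    intro U hU
    have hm : ∀ᶠ L : StrongDual ℝ E in 𝓝 0, Set.MapsTo L (c '' Metric.closedBall x 1) U :=
      ContinuousLinearMap.eventually_nhds_zero_mapsTo hbdd hU
    have h := (tendsto_sub_nhds_zero_iff.2 hA').eventually hm
    have hb : ∀ᶠ y in 𝓝[≠] x, y ∈ Metric.closedBall x 1 :=
      nhdsWithin_le_nhds (Metric.closedBall_mem_nhds x one_pos)
    exact (h.and hb).mono fun y hy => hy.1 (Set.mem_image_of_mem c hy.2)
  have h2 : Tendsto (fun y => A' (c y)) (𝓝[≠] x) (𝓝 (A' (c x))) :=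
    ((A'.continuous.comp hcont).tendsto x).mono_left nhdsWithin_le_nhds
  have h3 := ((A x).continuous.tendsto c').comp hc'
  have h4 := (h1.add h2).add h3
  rw [zero_add] at h4
  refine h4.congr fun y => ?_
  simp
  ring

theorem isSmoothCurve_const_add_smul_const [T2Space E] {g : ℝ → ℝ} (hg : ContDiff ℝ (⊤ : ℕ∞) g)
    (a v : E) : IsSmoothCurve fun t => a + g t • v := by
  -- The derivative has the same shape, with `0` for `a` and `g'` for `g`, so the induction must
  -- vary both.
  have key : ∀ (n : ℕ) (g : ℝ → ℝ) (a : E), ContDiff ℝ (⊤ : ℕ∞) g →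
      Differentiable ℝ (deriv^[n] fun t => a + g t • v) := by
    intro n
    induction n with
    | zero =>
      intro g a hg t
      have hd : DifferentiableAt ℝ g t := (hg.differentiable (by simp)) t
      exact ⟨_, (hasDerivAt_const_add_smul_const a v hd.hasDerivAt).hasFDerivAt⟩
    | succ n ih =>
      intro g a hg
      have hd : deriv (fun t => a + g t • v) = fun t => 0 + deriv g t • v := by
        funext t
        rw [zero_add]
        exact deriv_eq_of_hasDerivAt (hasDerivAt_const_add_smul_const a v
          ((hg.differentiable (by simp)) t).hasDerivAt)
      rw [Function.iterate_succ_apply, hd]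
      exact ih _ 0 (contDiff_infty_iff_deriv.1 hg).2
  exact fun n => key n g a hg

theorem eventually_line_mem {U : Set E} {x : E} (hU : U ∈ 𝓝 x) (v : E) :
    ∀ᶠ t : ℝ in 𝓝 0, x + t • v ∈ U := by
  have h : Continuous fun t : ℝ => x + t • v := by fun_prop
  exact h.continuousAt.eventually_mem (by simpa using hU)

/-- The germ at `0` of a straight line starting in an open set extends to a smooth curve in this
set. -/
theorem exists_isSmoothCurve_eventuallyEq_line [T2Space E] {U : Set E} {x : E} (hU : U ∈ 𝓝 x)
    (v : E) : ∃ c : ℝ → E, IsSmoothCurve c ∧ (∀ t, c t ∈ U) ∧ c 0 = x ∧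
      c =ᶠ[𝓝 0] fun t => x + t • v := by
  obtain ⟨r, hr, h⟩ := Metric.eventually_nhds_iff.1 (eventually_line_mem hU v)
  -- The line is reparametrised by `t * b t`, which is `t` near `0` and has absolute value below `r`
  -- everywhere.
  let b : ContDiffBump (0 : ℝ) := ⟨r / 2, r, by positivity, by linarith⟩
  refine ⟨fun t => x + (t * b t) • v, isSmoothCurve_const_add_smul_const
    (contDiff_id.mul b.contDiff) x v, fun t => h ?_, by simp, ?_⟩
  · rw [dist_zero_right, Real.norm_eq_abs, abs_mul, abs_of_nonneg b.nonneg]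
    by_cases ht : |t| < r
    · exact lt_of_le_of_lt (mul_le_of_le_one_right (abs_nonneg t) b.le_one) ht
    · rw [b.zero_of_le_dist (by simpa using ht), mul_zero]
      exact hr
  · filter_upwards [b.eventuallyEq_one] with t ht
    simp [ht]

end Calculus

/-! ### Cartan's formula and contact Hamiltonian fields -/

section Manifold

variable {E : Type*} [AddCommGroup E] [Module ℝ E] [TopologicalSpace E]
  [IsTopologicalAddGroup E] [ContinuousSMul ℝ E]
  {M : Type*} [TopologicalSpace M] [ChartedSpace E M]

namespace OneForm

variable (η : OneForm E M)

theorem isSmoothMapOn_rep (p : M) : IsSmoothMapOn (η.rep p) (chartAt E p).target :=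
  (η.smooth' (chartAt E p) (chart_mem_atlas E p)).choose_spec.1

theorem rep_chartVector (p : M) {q : M} (hq : q ∈ (chartAt E p).source) (v : TangentVector E q) :
    η.rep p (chartAt E p q) (chartVector (chartAt E p) q v) = η.toFun q v :=
  (η.smooth' (chartAt E p) (chart_mem_atlas E p)).choose_spec.2 q hq v

theorem extDeriv_swap (p : M) (v w : TangentVector E p) :
    η.extDeriv p v w = -η.extDeriv p w v := by
  simp [extDeriv]

theorem IsContact.reeb_spec {η : OneForm E M} (hη : η.IsContact) (p : M) :
    η.toFun p (hη.reeb p) = 1 ∧ ∀ w, η.extDeriv p (hη.reeb p) w = 0 :=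
  (hη.existsUnique_reeb p).choose_spec.1

end OneForm

variable [T2Space E]

/-- Read in the preferred chart, the path defining `v` is a straight line near time `0`. -/
theorem chartVector_chartAt (p : M) (v : TangentVector E p) :
    chartVector (chartAt E p) p v = v := by
  refine deriv_eq_of_hasDerivAt (F := E) ?_
  have h : HasDerivAt (fun t : ℝ => chartAt E p p + t • v) v 0 := by
    simpa using hasDerivAt_const_add_smul_const (chartAt E p p) v (hasDerivAt_id (0 : ℝ))
  refine hasDerivAt_iff_hasFDerivAt.2 (h.hasFDerivAt.congr_of_eventuallyEq ?_)
  filter_upwards [eventually_line_mem ((chartAt E p).open_target.mem_nhds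
    (mem_chart_target E p)) v] with t ht
  exact (chartAt E p).right_inv ht

theorem chartField_chartAt (X : (p : M) → TangentVector E p) (p : M) :
    chartField (chartAt E p) X (chartAt E p p) = X p := by
  rw [chartField, (chartAt E p).left_inv (mem_chart_source E p)]
  exact chartVector_chartAt p (X p)

namespace OneForm

variable (η : OneForm E M)

theorem rep_chartAt (p : M) (v : TangentVector E p) :
    η.rep p (chartAt E p p) v = η.toFun p v := by
  have h := η.rep_chartVector p (mem_chart_source E p) v
  rwa [chartVector_chartAt] at h

/-- The derivative in direction `v` of the function `η(X)`. -/
theorem differential_pairing (X : SmoothVectorField E M) (p : M) (v : TangentVector E p) :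
    differential (fun q => η.toFun q (X.toFun q)) p v =
      deriv (fun t : ℝ => η.rep p (chartAt E p p + t • v) (X.toFun p)) 0 +
      η.toFun p
        (deriv (fun t : ℝ => chartField (chartAt E p) X.toFun (chartAt E p p + t • v)) 0) := by
  set φ := chartAt E p with hφ
  have hU : φ.target ∈ 𝓝 (φ p) := φ.open_target.mem_nhds (mem_chart_target E p)
  obtain ⟨c, hc, hcU, hc0, hce⟩ := exists_isSmoothCurve_eventuallyEq_line hU v
  have hA := hasDerivAt_deriv (η.isSmoothMapOn_rep p c hc hcU 0 0)
  have hX : Differentiable ℝ (chartField φ X.toFun ∘ c) :=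
    X.smooth' φ (chart_mem_atlas E p) c hc hcU 0
  have hX0 := hasDerivAt_deriv (hX 0)
  have hXc : Continuous (chartField φ X.toFun ∘ c) :=
    continuous_iff_continuousAt.2 fun t => continuousAt_of_hasDerivAt (hasDerivAt_deriv (hX t))
  have hprod := hasDerivAt_pairing hA hX0 hXc
  have hcX : (chartField φ X.toFun ∘ c) 0 = X.toFun p := by
    rw [Function.comp_apply, hc0]
    exact chartField_chartAt X.toFun p
  have hcA : ∀ w, (deriv^[0] (η.rep p ∘ c)) 0 w = η.toFun p w := by
    intro w
    simp only [Function.iterate_zero, id_eq, Function.comp_apply, hc0]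
    exact η.rep_chartAt p w
  rw [hcX, hcA] at hprod
  have heq1 : (fun t : ℝ => η.toFun (φ.symm (φ p + t • v)) (X.toFun (φ.symm (φ p + t • v))))
      =ᶠ[𝓝 0] fun t => (deriv^[0] (η.rep p ∘ c)) t ((chartField φ X.toFun ∘ c) t) := by
    filter_upwards [hce] with t ht
    have hm : φ p + t • v ∈ φ.target := ht ▸ hcU t
    simp only [Function.iterate_zero, id_eq, Function.comp_apply, ht]
    have h := η.rep_chartVector p (φ.map_target hm) (X.toFun (φ.symm (φ p + t • v)))
    rw [← hφ, φ.right_inv hm] at h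
    exact h.symm
  -- Pairing with a constant curve differentiates the form alone, which identifies the first
  -- summand.
  have hconst : HasDerivAt (fun _ : ℝ => X.toFun p) 0 0 := by
    simpa using hasDerivAt_const_add_smul_const (X.toFun p) 0 (hasDerivAt_id (0 : ℝ))
  have heval := hasDerivAt_pairing hA hconst continuous_const
  rw [map_zero, add_zero] at heval
  have heq2 : (fun t : ℝ => η.rep p (φ p + t • v) (X.toFun p)) =ᶠ[𝓝 0]
      fun t => (deriv^[0] (η.rep p ∘ c)) t (X.toFun p) := by
    filter_upwards [hce] with t ht
    simp [ht]
  have heq3 : (fun t : ℝ => chartField φ X.toFun (φ p + t • v)) =ᶠ[𝓝 0]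
      chartField φ X.toFun ∘ c := by
    filter_upwards [hce] with t ht
    simp [ht]
  have hd3 : deriv (fun t : ℝ => chartField φ X.toFun (φ p + t • v)) 0 =
      deriv (chartField φ X.toFun ∘ c) 0 :=
    deriv_eq_of_hasDerivAt
      (hasDerivAt_iff_hasFDerivAt.2 (hX0.hasFDerivAt.congr_of_eventuallyEq heq3))
  rw [differential, ← hφ, heq1.deriv_eq, hprod.deriv, heq2.deriv_eq, hd3]
  congr 1
  exact heval.deriv.symm

/-- Cartan's formula `L_X η = ι_X dη + d(η(X))`. -/
theorem lieDeriv_eq (X : SmoothVectorField E M) (p : M) (v : TangentVector E p) :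
    η.lieDeriv X p v = η.extDeriv p (X.toFun p) v +
      differential (fun q => η.toFun q (X.toFun q)) p v := by
  -- The term `(D_v η)(X)` enters `dη(X, v)` and `d(η(X))(v)` with opposite signs and cancels.
  rw [differential_pairing, lieDeriv, extDeriv]
  ring

variable {η}

theorem HamiltonianConditions.extDeriv_eq {H f : M → ℝ} {X : SmoothVectorField E M}
    (h : η.HamiltonianConditions H X f) (p : M) (v : TangentVector E p) :
    η.extDeriv p (X.toFun p) v = differential H p v + f p * η.toFun p v := by
  have h1 : (fun q => η.toFun q (X.toFun q)) = fun q => -H q := funext h.1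
  have h2 : differential (E := E) (fun q => -H q) p v = -differential H p v := by
    simp [differential]
  have h3 := η.lieDeriv_eq X p v
  rw [h.2, h1, h2] at h3
  linarith

theorem HamiltonianConditions.factor_eq (hη : η.IsContact) {H f : M → ℝ}
    {X : SmoothVectorField E M} (h : η.HamiltonianConditions H X f) (p : M) :
    f p = -differential H p (hη.reeb p) := by
  have h1 := h.extDeriv_eq p (hη.reeb p)
  -- By antisymmetry `dη(X, R) = -dη(R, X) = 0`, while `η(R) = 1` isolates `f`.
  rw [extDeriv_swap, (hη.reeb_spec p).2, (hη.reeb_spec p).1] at h1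
  linarith

theorem HamiltonianConditions.flat_eq (hη : η.IsContact) {H f : M → ℝ}
    {X : SmoothVectorField E M} (h : η.HamiltonianConditions H X f) (p : M)
    (v : TangentVector E p) :
    η.flat p (X.toFun p) v = differential H p v
      - (differential H p (hη.reeb p) + H p) * η.toFun p v := by
  rw [flat, h.extDeriv_eq, h.1, h.factor_eq hη]
  ring

end OneForm

end Manifold

end Convenient

theorem mainTheorem5 {E : Type*} [AddCommGroup E] [Module ℝ E] [TopologicalSpace E]
    [IsTopologicalAddGroup E] [ContinuousSMul ℝ E] [LocallyConvexSpace ℝ E] [T2Space E]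
    [Convenient.ConvenientSpace E]
    {M : Type*} [TopologicalSpace M] [ChartedSpace E M] [Convenient.IsConvenientManifold E M]
    (η : Convenient.OneForm E M) (hη : η.IsContact)
    (H : M → ℝ) (hH : Convenient.IsSmoothFunction E H) :
    (∀ X Y : Convenient.SmoothVectorField E M,
      η.IsHamiltonianVectorField H X → η.IsHamiltonianVectorField H Y → X = Y) ∧
    (∀ (X : Convenient.SmoothVectorField E M) (f : M → ℝ),
      Convenient.IsSmoothFunction E f → η.HamiltonianConditions H X f →
        (∀ p : M, f p = - Convenient.differential H p (hη.reeb p)) ∧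
        (∀ (p : M) (v : Convenient.TangentVector E p),
          η.flat p (X.toFun p) v =
            Convenient.differential H p v
              - (Convenient.differential H p (hη.reeb p) + H p) * η.toFun p v)) := by

  refine ⟨?_, fun X f _ h => ⟨h.factor_eq hη, h.flat_eq hη⟩⟩
  rintro X Y ⟨f, _, hX⟩ ⟨g, _, hY⟩
  ext p
  refine hη.flat_injective p (funext fun v => ?_)
  rw [hX.flat_eq hη, hY.flat_eq hη]
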